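/- Let $n\ge 2$, $k\ge 1$ and $N$ be integers with $D(n,2k-1)\le N\le D(n,2k)$, where $D(n,2k-1)=2\binom{n+k-2}{n-1}$ and $D(n,2k)=\binom{n+k-1}{n-1}+\binom{n+k-2}{n-1}$. Let $P_i^{(n)}$ be the Gegenbauer polynomials, given by $P_0^{(n)}=1$, $P_1^{(n)}(t)=t$ and $(i+n-2)P_{i+1}^{(n)}(t)=(2i+n-2)\,t\,P_i^{(n)}(t)-i\,P_{i-1}^{(n)}(t)$ for $i\ge1$ (so $P_i^{(n)}(1)=1$), and write every real polynomial as $f=\sum_i f_iP_i^{(n)}$. Let $-1\le\alpha_0<\dots<\alpha_{k-1}<1$ and $\rho_0,\dots,\rho_{k-1}>0$ be the uniquely determined nodes and weights of the Levenshtein quadrature $$f_0=\frac{f(1)}N+\sum_{i=0}^{k-1}\rho_i f(\alpha_i)\qquad\text{for all real polynomials } f \text{ with } \deg f\le 2k-1,$$ put $s=\alpha_{k-1}$ and, for $j\ge1$, $$Q_j(n,s)=\frac1N+\sum_{i=0}^{k-1}\rho_iP_j^{(n)}(\alpha_i).$$ Let $h:[-1,1]\to[0,+\infty]$ be strictly absolutely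 monotone, i.e. $h$ is finite and infinitely differentiable on $[-1,1)$ with $h^{(m)}(t)>0$ for all $m\ge0$ and $t\in[-1,1)$ (one-sided derivatives at $-1$), and let $h(t)\le h(1)$ for $t\in[-1,1)$. Let $A_{n,2k-1;h}$ be the set of real polynomials $f$ with $f(t)\le h(t)$ for all $t\in[-1,1]$ and $f_i\ge0$ for all $i\ge 2k$. Say that $f\in A_{n,2k-1;h}$ improves the universal bound $N^2\sum_{i=0}^{k-1}\rho_ih(\alpha_i)$ if $$N\,(Nf_0-f(1))>N^2\sum_{i=0}^{k-1}\rho_ih(\alpha_i).$$ (a) The universal bound is improved by some polynomial of degree at least $2k$ in $A_{n,2k-1;h}$ if and only if $Q_j(n,s)<0$ for some $j\ge2k$. (b) If $j\ge 2k$ and $Q_j(n,s)<0$, then the universal bound is improved by a polynomial $f\in A_{n,2k-1;h}$ of degree exactly $j$. More precisely, there are $\varepsilon>0$ and a polynomial $g$ of degree at most $2k-1$ with $$g(\alpha_i)=h(\alpha_i)-\varepsilon P_j^{(n)}(\alpha_i),\qquad g'(\alpha_i)=h'(\alpha_i)-\varepsilon (P_j^{(n)})'(\alpha_i)\qquad(0\le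 i\le k-1)$$ such that $f=\varepsilon P_j^{(n)}+g$ has these properties. -/

import Mathlib

open Polynomial
open scoped ENNReal

namespace LevenshteinLP

/-- The Gegenbauer polynomials `P_i^{(n)}`, normalized by `P_i^{(n)}(1) = 1`:
`P_0 = 1`, `P_1 = t` and `(i + n - 2) P_{i+1} = (2 i + n - 2) t P_i - i P_{i-1}` for `i ≥ 1`
(below `i` is shifted by one). They are meant for `n ≥ 2`. -/
noncomputable def gegenbauer (n : ℕ) : ℕ → ℝ[X]
  | 0 => 1
  | 1 => X
  | i + 2 =>
      C ((2 * (i + 1) + n - 2 : ℝ) / ((i + 1) + n - 2)) * X * gegenbauer n (i + 1)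
        - C ((i + 1 : ℝ) / ((i + 1) + n - 2)) * gegenbauer n i

/-- The coefficient sequence `(f_i)` of the unique expansion `f = ∑ i, f_i P_i^{(n)}`
(existence and uniqueness for `n ≥ 2`: see `sum_gegenbauerCoeff`, `gegenbauerCoeff_unique`). -/
noncomputable def gegenbauerCoeff (n : ℕ) (f : ℝ[X]) : ℕ →₀ ℝ :=
  Function.invFun (Finsupp.linearCombination ℝ (gegenbauer n)) f

theorem gegenbauer_natDegree_coeff {n : ℕ} (hn : 2 ≤ n) (i : ℕ) :
    (gegenbauer n i).natDegree ≤ i ∧ 0 < (gegenbauer n i).coeff i := by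
  have hn' : (2 : ℝ) ≤ n := by exact_mod_cast hn
  induction i using Nat.strong_induction_on with
  | _ i ih =>
    match i with
    | 0 => simp [gegenbauer]
    | 1 => simp [gegenbauer]
    | i + 2 =>
      obtain ⟨d1, c1⟩ := ih (i + 1) (by omega)
      obtain ⟨d0, c0⟩ := ih i (by omega)
      constructor
      · rw [gegenbauer]
        refine (natDegree_sub_le _ _).trans (max_le ?_ ?_)
        · rw [mul_assoc]
          refine (natDegree_C_mul_le _ _).trans (natDegree_mul_le.trans ?_)
          rw [natDegree_X]; omega
        · exact (natDegree_C_mul_le _ _).trans (by omega)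
      · rw [gegenbauer, coeff_sub, mul_assoc, coeff_C_mul, coeff_C_mul, coeff_X_mul,
          coeff_eq_zero_of_natDegree_lt (p := gegenbauer n i) (by omega), mul_zero, sub_zero]
        have hi : (0 : ℝ) ≤ i := Nat.cast_nonneg i
        exact mul_pos (div_pos (by linarith) (by linarith)) c1

theorem gegenbauer_bijective {n : ℕ} (hn : 2 ≤ n) :
    Function.Bijective (Finsupp.linearCombination ℝ (gegenbauer n)) := by
  let S : Polynomial.Sequence ℝ :=
    ⟨gegenbauer n, fun i => degree_eq_of_le_of_coeff_ne_zero
      (natDegree_le_iff_degree_le.1 (gegenbauer_natDegree_coeff hn i).1)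
      (gegenbauer_natDegree_coeff hn i).2.ne'⟩
  have hu : ∀ i, IsUnit (S i).leadingCoeff := fun i =>
    (leadingCoeff_ne_zero.2 (S.ne_zero i)).isUnit
  have h1 : LinearIndependent ℝ (gegenbauer n) := S.linearIndependent
  have h2 : Submodule.span ℝ (Set.range (gegenbauer n)) = ⊤ := S.span hu
  refine ⟨h1, ?_⟩
  rw [← LinearMap.range_eq_top, Finsupp.range_linearCombination, h2]

theorem sum_gegenbauerCoeff {n : ℕ} (hn : 2 ≤ n) (f : ℝ[X]) :
    Finsupp.linearCombination ℝ (gegenbauer n) (gegenbauerCoeff n f) = f :=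
  Function.rightInverse_invFun (gegenbauer_bijective hn).2 f

theorem gegenbauerCoeff_unique {n : ℕ} (hn : 2 ≤ n) (c : ℕ →₀ ℝ) :
    gegenbauerCoeff n (Finsupp.linearCombination ℝ (gegenbauer n) c) = c :=
  Function.leftInverse_invFun (gegenbauer_bijective hn).1 c

/-- The Delsarte-Goethals-Seidel number `D(n, τ)`: with `τ = 2 k - 1` it is
`2 * binom (n + k - 2) (n - 1)`, with `τ = 2 k` it is
`binom (n + k - 1) (n - 1) + binom (n + k - 2) (n - 1)`. -/
def delsarteBound (n τ : ℕ) : ℕ :=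
  if Odd τ then 2 * (n + (τ + 1) / 2 - 2).choose (n - 1)
  else (n + τ / 2 - 1).choose (n - 1) + (n + τ / 2 - 2).choose (n - 1)

/-- `α_0 < ⋯ < α_{k-1}` and `ρ_0, …, ρ_{k-1} > 0` are the nodes and the weights of the
Levenshtein quadrature `f_0 = f(1) / N + ∑ i, ρ_i f(α_i)`, exact for all real polynomials of
degree at most `2 k - 1`. They are uniquely determined by `n`, `k`, `N`
(see `IsLevenshteinQuadrature.unique`); the largest node is the number `s` with
`N = L_{2k-1}(n, s)`. The value `α_0 = -1` occurs only for `N = D(n, 2k-1)`. -/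
structure IsLevenshteinQuadrature (n k N : ℕ) (α ρ : Fin k → ℝ) : Prop where
  strictMono : StrictMono α
  mem_Ico : ∀ i, α i ∈ Set.Ico (-1 : ℝ) 1
  weight_pos : ∀ i, 0 < ρ i
  exactness : ∀ f : ℝ[X], f.natDegree ≤ 2 * k - 1 →
    gegenbauerCoeff n f 0 = f.eval 1 / N + ∑ i, ρ i * f.eval (α i)

theorem IsLevenshteinQuadrature.unique {n k N : ℕ} {α ρ α' ρ' : Fin k → ℝ}
    (h : IsLevenshteinQuadrature n k N α ρ) (h' : IsLevenshteinQuadrature n k N α' ρ') :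
    α = α' ∧ ρ = ρ' := by
  classical
  have hlag : ∀ i : Fin k, (Lagrange.basis Finset.univ α' i).natDegree ≤ k - 1 := fun i => by
    rw [Lagrange.natDegree_basis (h'.strictMono.injective.injOn) (Finset.mem_univ i)]; simp
  have heq : ∀ f : ℝ[X], f.natDegree ≤ 2 * k - 1 →
      ∑ i, ρ i * f.eval (α i) = ∑ i, ρ' i * f.eval (α' i) := fun f hf => by
    have a := h.exactness f hf
    have b := h'.exactness f hf
    linarith
  have hsum : ∀ (g : ℝ → ℝ) (i : Fin k),
      ∑ j, ρ' j * (g (α' j) * (Lagrange.basis Finset.univ α' i).eval (α' j))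
        = ρ' i * g (α' i) := fun g i => by
    rw [Finset.sum_eq_single i]
    · rw [Lagrange.eval_basis_self (h'.strictMono.injective.injOn) (Finset.mem_univ i), mul_one]
    · intro j _ hj
      rw [Lagrange.eval_basis_of_ne hj.symm (Finset.mem_univ j)]; simp
    · simp
  have hroot : ∀ i, ∃ j, α j = α' i := fun i => by
    have hk : 0 < k := i.pos
    have e := heq ((∏ j, (X - C (α j))) * Lagrange.basis Finset.univ α' i) (by
      refine natDegree_mul_le.trans ?_
      have := hlag i
      rw [natDegree_finsetProd_X_sub_C_eq_card]
      simp only [Finset.card_univ, Fintype.card_fin]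
      omega)
    simp only [eval_mul] at e
    have e2 := hsum (fun x => (∏ j, (X - C (α j))).eval x) i
    rw [e2, Finset.sum_eq_zero] at e
    · have e' := (mul_eq_zero.1 e.symm).resolve_left (h'.weight_pos i).ne'
      rw [eval_prod, Finset.prod_eq_zero_iff] at e'
      obtain ⟨j, _, hj⟩ := e'
      exact ⟨j, by simp at hj; linarith⟩
    · intro j _
      rw [eval_prod, Finset.prod_eq_zero (Finset.mem_univ j) (by simp)]; simp
  have hα : α = α' := by
    choose g hg using hroot
    have hgm : StrictMono g := fun a b hab => by
      rw [← h.strictMono.lt_iff_lt, hg, hg]; exact h'.strictMono hab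
    have hid : g = id := hgm.eq_id
    funext i
    rw [← hg i, hid, id]
  subst hα
  refine ⟨rfl, ?_⟩
  funext i
  have hk : 0 < k := i.pos
  have e := heq (Lagrange.basis Finset.univ α i) ((hlag i).trans (by omega))
  have key : ∀ σ : Fin k → ℝ,
      ∑ j, σ j * (Lagrange.basis Finset.univ α i).eval (α j) = σ i := fun σ => by
    rw [Finset.sum_eq_single i]
    · rw [Lagrange.eval_basis_self (h.strictMono.injective.injOn) (Finset.mem_univ i), mul_one]
    · intro j _ hj
      rw [Lagrange.eval_basis_of_ne hj.symm (Finset.mem_univ j)]; simp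
    · simp
  rwa [key, key] at e

/-- The test function `Q_j(n, s) = 1 / N + ∑ i, ρ_i P_j^{(n)}(α_i)`, where `s = α_{k-1}` and
`N = L_{2k-1}(n, s)`. -/
noncomputable def testFunction {k : ℕ} (n N : ℕ) (α ρ : Fin k → ℝ) (j : ℕ) : ℝ :=
  1 / N + ∑ i, ρ i * (gegenbauer n j).eval (α i)

/-- `h` is finite on `[-1, 1)` and `h^{(m)}(t) > 0` for all `m ≥ 0` and `t ∈ [-1, 1)`
(one-sided derivatives at `-1`). -/
def StrictlyAbsolutelyMonotone (h : ℝ → ℝ≥0∞) : Prop :=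
  (∀ t ∈ Set.Ico (-1 : ℝ) 1, h t ≠ ⊤) ∧
  ContDiffOn ℝ ((⊤ : ℕ∞) : WithTop ℕ∞) (fun t => (h t).toReal) (Set.Ico (-1) 1) ∧
  ∀ m : ℕ, ∀ t ∈ Set.Ico (-1 : ℝ) 1,
    0 < iteratedDerivWithin m (fun t => (h t).toReal) (Set.Ico (-1) 1) t

/-- The set `A_{n, τ, I; h}` of real polynomials `f` with `f ≤ h` on `I` and with nonnegative
Gegenbauer coefficients `f_i` for `i ≥ τ + 1`. -/
def admissible (n τ : ℕ) (I : Set ℝ) (h : ℝ → ℝ≥0∞) : Set ℝ[X] :=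
  {f | (∀ t ∈ I, ((f.eval t : ℝ) : EReal) ≤ (h t : EReal)) ∧
    ∀ i, τ + 1 ≤ i → 0 ≤ gegenbauerCoeff n f i}

/-- The universal lower bound `N² ∑ i, ρ_i h(α_i)` for odd strength. -/
noncomputable def universalBound {k : ℕ} (N : ℕ) (α ρ : Fin k → ℝ) (h : ℝ → ℝ≥0∞) : ℝ :=
  (N : ℝ) ^ 2 * ∑ i, ρ i * (h (α i)).toReal

/-- The linear programming bound `N (N f_0 - f(1))` given by the polynomial `f`. -/
noncomputable def lpBound (n N : ℕ) (f : ℝ[X]) : ℝ :=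
  N * (N * gegenbauerCoeff n f 0 - f.eval 1)

/-- `g` is the Hermite interpolant of `φ : [-1, 1) → ℝ`, of degree at most `2 k - 1`, that agrees
with `φ` to first order at the `k` nodes `α_i` (one-sided derivative of `φ` at `-1`). -/
def IsHermiteInterpolant {k : ℕ} (α : Fin k → ℝ) (φ : ℝ → ℝ) (g : ℝ[X]) : Prop :=
  g.natDegree ≤ 2 * k - 1 ∧
  ∀ i, g.eval (α i) = φ (α i) ∧
    g.derivative.eval (α i) = derivWithin φ (Set.Ico (-1) 1) (α i)

end LevenshteinLP

open LevenshteinLP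

/-! ### Rolle counting and Hermite interpolation -/

section Analysis

/-! Expanding `f` in Gegenbauer polynomials and using exactness below degree `2k` gives `N (N f_0 -
f(1)) = N² (∑ ρ_i f(α_i) - ∑_{j ≥ 2k} f_j Q_j)` (`IsLevenshteinQuadrature.lpBound_eq`). If every
`Q_j` is nonnegative, then `f ≤ h` at the nodes rules out an improvement. If `Q_j < 0`, take `f = ε
P_j + g` tangent to `h` at all nodes: the gain is `-N² ε Q_j > 0`. Since `deg g < 2k`, the
derivative of order `2k` of `h - f` is `h^{(2k)} - ε P_j^{(2k)}`, which is nonnegative for small `ε`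
because `h^{(2k)}` is bounded below by a positive constant. As `h - f` has `k` double zeros,
`nonneg_of_double_zeros` then yields `f ≤ h`. -/

/-- Rolle between consecutive points of `Z`. Disjointness from `Z` allows these zeros to be counted
in addition to the double zeros of `f`. -/
theorem exists_finset_derivWithin_eq_zero {s : Set ℝ} (hs : s.OrdConnected) {f : ℝ → ℝ}
    (hf : DifferentiableOn ℝ f s) {m : ℕ} {Z : Finset ℝ} (hZ : ∀ z ∈ Z, z ∈ s)
    (hcard : Z.card = m + 1) (hzero : ∀ z ∈ Z, f z = 0) :
    ∃ W : Finset ℝ, W.card = m ∧ Disjoint W Z ∧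
      ∀ w ∈ W, w ∈ s ∧ derivWithin f s w = 0 := by
  classical
  let e := Z.orderEmbOfFin hcard
  have he : ∀ i, e i ∈ Z := Z.orderEmbOfFin_mem hcard
  have key : ∀ i : Fin m, ∃ w, w ∈ Set.Ioo (e i.castSucc) (e i.succ) ∧ w ∈ s ∧
      derivWithin f s w = 0 := fun i => by
    have hsub : Set.Icc (e i.castSucc) (e i.succ) ⊆ s :=
      hs.out (hZ _ (he _)) (hZ _ (he _))
    obtain ⟨w, hw, hd⟩ := exists_deriv_eq_zero (e.strictMono i.castSucc_lt_succ)
      (hf.continuousOn.mono hsub) ((hzero _ (he _)).trans (hzero _ (he _)).symm)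
    refine ⟨w, hw, hsub (Set.Ioo_subset_Icc_self hw), ?_⟩
    rw [derivWithin_of_mem_nhds, hd]
    exact Filter.mem_of_superset (Ioo_mem_nhds hw.1 hw.2) (Set.Ioo_subset_Icc_self.trans hsub)
  choose w hw hws hwd using key
  have hmono : StrictMono w := fun i j hij =>
    (hw i).2.trans_le ((e.monotone (by
      rw [Fin.le_def, Fin.val_succ, Fin.val_castSucc]; exact hij)).trans (hw j).1.le)
  refine ⟨Finset.univ.image w, ?_, ?_, ?_⟩
  · rw [Finset.card_image_of_injective _ hmono.injective, Finset.card_univ, Fintype.card_fin]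
  · rw [Finset.disjoint_left]
    intro x hx hxZ
    obtain ⟨i, -, rfl⟩ := Finset.mem_image.1 hx
    have hr : w i ∈ Set.range e := by
      rw [Finset.range_orderEmbOfFin]; exact hxZ
    obtain ⟨l, hl⟩ := hr
    have h1 := hw i
    rw [← hl] at h1
    have h2 := e.lt_iff_lt.1 h1.1
    have h3 := e.lt_iff_lt.1 h1.2
    rw [Fin.lt_def] at h2 h3
    simp only [Fin.val_succ, Fin.val_castSucc] at h2 h3
    omega
  · intro x hx
    obtain ⟨i, -, rfl⟩ := Finset.mem_image.1 hx
    exact ⟨hws i, hwd i⟩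

theorem exists_iteratedDerivWithin_eq_zero {s : Set ℝ} (hs : s.OrdConnected)
    (hu : UniqueDiffOn ℝ s) {m : ℕ} {f : ℝ → ℝ} (hf : ContDiffOn ℝ m f s) {Z : Finset ℝ}
    (hZ : ∀ z ∈ Z, z ∈ s) (hcard : Z.card = m + 1) (hzero : ∀ z ∈ Z, f z = 0) :
    ∃ x ∈ s, iteratedDerivWithin m f s x = 0 := by
  induction m generalizing f Z with
  | zero =>
    obtain ⟨z, hz⟩ : Z.Nonempty := Finset.card_pos.1 (by omega)
    exact ⟨z, hZ z hz, by simpa using hzero z hz⟩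
  | succ m ih =>
    obtain ⟨W, hWc, -, hW⟩ := exists_finset_derivWithin_eq_zero hs
      (hf.differentiableOn (by simp)) hZ hcard hzero
    rw [iteratedDerivWithin_succ']
    exact ih (hf.derivWithin hu (by simp)) (fun w hw => (hW w hw).1) hWc
      (fun w hw => (hW w hw).2)

theorem iteratedDerivWithin_polynomial_eval {s : Set ℝ} (hu : UniqueDiffOn ℝ s) (p : ℝ[X])
    (m : ℕ) {x : ℝ} (hx : x ∈ s) :
    iteratedDerivWithin m (fun t => p.eval t) s x = (derivative^[m] p).eval x := by
  induction m generalizing p with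
  | zero => simp
  | succ m ih =>
    rw [iteratedDerivWithin_succ', iteratedDerivWithin_congr
      (fun t ht => p.derivWithin (hu t ht)) hx, ih, Function.iterate_succ_apply]

theorem contDiff_eval (p : ℝ[X]) {m : WithTop ℕ∞} : ContDiff ℝ m fun x => p.eval x := by
  simpa using p.contDiff_aeval (𝕜 := ℝ) m

theorem eval_iterate_derivative_monic {p : ℝ[X]} (hp : p.Monic) (x : ℝ) :
    (derivative^[p.natDegree] p).eval x = (p.natDegree.factorial : ℝ) := by
  have h0 : (derivative^[p.natDegree] p).natDegree ≤ 0 := by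
    simpa using natDegree_iterate_derivative p p.natDegree
  rw [eq_C_of_natDegree_le_zero h0, eval_C, coeff_iterate_derivative, zero_add,
    hp.coeff_natDegree, Nat.descFactorial_self]
  simp

/-- The sign of the Hermite interpolation error: a function that vanishes to first order at the
points of `A` and whose derivative of order `2 * #A` is nonnegative is itself nonnegative. -/
theorem nonneg_of_double_zeros {s : Set ℝ} (hs : s.OrdConnected) (hu : UniqueDiffOn ℝ s)
    {A : Finset ℝ} (hA : ∀ a ∈ A, a ∈ s) (hne : A.Nonempty) {f : ℝ → ℝ}
    (hf : ContDiffOn ℝ (2 * A.card : ℕ) f s) (h0 : ∀ a ∈ A, f a = 0)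
    (h1 : ∀ a ∈ A, derivWithin f s a = 0)
    (hpos : ∀ x ∈ s, 0 ≤ iteratedDerivWithin (2 * A.card) f s x) {t : ℝ} (ht : t ∈ s) :
    0 ≤ f t := by
  classical
  by_cases htA : t ∈ A
  · rw [h0 t htA]
  obtain ⟨m, hm⟩ : ∃ m, 2 * A.card = m + 1 := ⟨2 * A.card - 1, by have := hne.card_pos; omega⟩
  let p : ℝ[X] := Lagrange.nodal A id
  let q : ℝ[X] := p ^ 2
  have hq : q.Monic := Lagrange.nodal_monic.pow 2
  have hqd : q.natDegree = 2 * A.card := by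
    rw [natDegree_pow, Lagrange.natDegree_nodal]
  have hpt : p.eval t ≠ 0 := by
    refine Lagrange.eval_nodal_not_at_node fun a ha hta => htA ?_
    rw [hta]; exact ha
  have hpa : ∀ a ∈ A, p.eval a = 0 := fun a ha =>
    Lagrange.eval_nodal_at_node (v := id) ha
  -- `K` is chosen so that `G = f - K q` vanishes at `t` as well as on `A`.
  let K := f t / q.eval t
  have hqt : 0 < q.eval t := by
    rw [eval_pow]; positivity
  let r : ℝ[X] := C K * q
  have hr : ContDiff ℝ (2 * A.card : ℕ) (fun x => r.eval x) := contDiff_eval r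
  let G : ℝ → ℝ := f - fun x => r.eval x
  have hG : ContDiffOn ℝ (2 * A.card : ℕ) G s := hf.sub hr.contDiffOn
  have hfd : DifferentiableOn ℝ f s := hf.differentiableOn (by
    rw [hm]; simp)
  have hGd : DifferentiableOn ℝ G s := hfd.sub r.differentiable.differentiableOn
  obtain ⟨W, hWc, hWd, hW⟩ := exists_finset_derivWithin_eq_zero (m := A.card)
    (Z := insert t A) hs hGd
    (fun z hz => by
      rcases Finset.mem_insert.1 hz with rfl | hz
      exacts [ht, hA z hz])
    (Finset.card_insert_of_notMem htA)
    (fun z hz => by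
      rcases Finset.mem_insert.1 hz with rfl | hz
      · change f z - eval z (C K * q) = 0
        rw [eval_mul, eval_C, div_mul_cancel₀ _ hqt.ne', sub_self]
      · change f z - eval z (C K * p ^ 2) = 0
        simp [h0 z hz, hpa z hz])
  -- `G'` vanishes at the `#A` Rolle points and again on `A`: `2 * #A` distinct zeros, so the
  -- derivative of `G` of order `2 * #A` has a zero.
  have hdisj : Disjoint W A := hWd.mono_right (Finset.subset_insert _ _)
  have hUs : ∀ z ∈ W ∪ A, z ∈ s ∧ derivWithin G s z = 0 := fun z hz => by
    rcases Finset.mem_union.1 hz with hz | hz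
    · exact hW z hz
    · refine ⟨hA z hz, ?_⟩
      rw [derivWithin_sub (hfd z (hA z hz)) r.differentiable.differentiableAt.differentiableWithinAt,
        h1 z hz, r.derivWithin (hu z (hA z hz))]
      simp [r, q, derivative_pow, hpa z hz]
  obtain ⟨x, hx, hGx⟩ := exists_iteratedDerivWithin_eq_zero (m := m) hs hu
    (f := derivWithin G s) (Z := W ∪ A)
    (hG.derivWithin hu (by rw [hm]; simp)) (fun z hz => (hUs z hz).1)
    (by rw [Finset.card_union_of_disjoint hdisj, hWc]; omega) (fun z hz => (hUs z hz).2)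
  -- At `x` the derivative of `f` of order `2 * #A` equals `K * (2 * #A)!`, so `K` inherits its
  -- sign.
  rw [← iteratedDerivWithin_succ', ← hm, iteratedDerivWithin_sub hx hu (hf x hx)
    hr.contDiffWithinAt, iteratedDerivWithin_polynomial_eval hu r _ hx,
    iterate_derivative_C_mul, eval_mul, eval_C, ← hqd, eval_iterate_derivative_monic hq,
    hqd] at hGx
  have hK : 0 ≤ K := by
    have hfx := hpos x hx
    by_contra hK
    have : K * ((2 * A.card).factorial : ℝ) < 0 :=
      mul_neg_of_neg_of_pos (not_le.1 hK) (by positivity)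
    linarith
  have : f t = K * q.eval t := (div_mul_cancel₀ _ hqt.ne').symm
  rw [this]
  exact mul_nonneg hK hqt.le

/-- Take `g = a + p b` with `p` the nodal polynomial: `a` fixes the values, and `b` corrects the
derivatives, since `p' ≠ 0` at the simple roots of `p`. -/
theorem exists_hermite_interpolant {k : ℕ} {α : Fin k → ℝ} (hα : Function.Injective α)
    (y y' : Fin k → ℝ) :
    ∃ g : ℝ[X], g.natDegree ≤ 2 * k - 1 ∧
      ∀ i, g.eval (α i) = y i ∧ g.derivative.eval (α i) = y' i := by
  classical
  let p : ℝ[X] := Lagrange.nodal Finset.univ α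
  let a : ℝ[X] := Lagrange.interpolate Finset.univ α y
  let b : ℝ[X] := Lagrange.interpolate Finset.univ α
    fun i => (y' i - a.derivative.eval (α i)) / p.derivative.eval (α i)
  have hdeg : ∀ z : Fin k → ℝ, (Lagrange.interpolate Finset.univ α z).natDegree ≤ k - 1 :=
    fun z => by
      have := Lagrange.degree_interpolate_le (s := Finset.univ) (v := α) z hα.injOn
      rw [Finset.card_univ, Fintype.card_fin] at this
      exact natDegree_le_of_degree_le this
  have hp : p.natDegree = k := by
    rw [Lagrange.natDegree_nodal, Finset.card_univ, Fintype.card_fin]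
  refine ⟨a + p * b, ?_, fun i => ?_⟩
  · rcases Nat.eq_zero_or_pos k with rfl | hk
    · simp [a, b]
    refine (natDegree_add_le _ _).trans (max_le ((hdeg _).trans (by omega)) ?_)
    refine natDegree_mul_le.trans ?_
    have : b.natDegree ≤ k - 1 := hdeg _
    omega
  · have hpi : p.eval (α i) = 0 := Lagrange.eval_nodal_at_node (Finset.mem_univ i)
    have ha : a.eval (α i) = y i :=
      Lagrange.eval_interpolate_at_node _ hα.injOn (Finset.mem_univ i)
    have hb : b.eval (α i) = (y' i - a.derivative.eval (α i)) / p.derivative.eval (α i) :=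
      Lagrange.eval_interpolate_at_node _ hα.injOn (Finset.mem_univ i)
    have hd : p.derivative.eval (α i) ≠ 0 := by
      rw [Lagrange.eval_nodal_derivative_eval_node_eq (Finset.mem_univ i)]
      refine Lagrange.eval_nodal_not_at_node fun j hj h => ?_
      exact (Finset.ne_of_mem_erase hj) (hα h).symm
    refine ⟨by simp [hpi, ha], ?_⟩
    rw [derivative_add, derivative_mul, eval_add, eval_add, eval_mul, eval_mul, hpi, hb,
      mul_div_cancel₀ _ hd]
    ring

end Analysis

/-! ### Gegenbauer expansions and the quadrature error -/

namespace LevenshteinLP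

theorem gegenbauer_natDegree {n : ℕ} (hn : 2 ≤ n) (i : ℕ) : (gegenbauer n i).natDegree = i :=
  natDegree_eq_of_le_of_coeff_ne_zero (gegenbauer_natDegree_coeff hn i).1
    (gegenbauer_natDegree_coeff hn i).2.ne'

theorem gegenbauer_eval_one {n : ℕ} (hn : 2 ≤ n) (i : ℕ) : (gegenbauer n i).eval 1 = 1 := by
  have hn' : (2 : ℝ) ≤ n := by exact_mod_cast hn
  induction i using Nat.strong_induction_on with
  | _ i ih =>
    match i with
    | 0 => simp [gegenbauer]
    | 1 => simp [gegenbauer]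
    | i + 2 =>
      have hi : (0 : ℝ) ≤ i := Nat.cast_nonneg i
      have h0 : ((i + 1) + n - 2 : ℝ) ≠ 0 := by
        have : (0 : ℝ) < (i + 1) + n - 2 := by linarith
        exact this.ne'
      rw [gegenbauer]
      simp only [eval_sub, eval_mul, eval_C, eval_X, ih (i + 1) (by omega), ih i (by omega)]
      field_simp
      ring

theorem gegenbauerCoeff_add {n : ℕ} (hn : 2 ≤ n) (f g : ℝ[X]) :
    gegenbauerCoeff n (f + g) = gegenbauerCoeff n f + gegenbauerCoeff n g := by
  apply (gegenbauer_bijective hn).1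
  rw [map_add, sum_gegenbauerCoeff hn, sum_gegenbauerCoeff hn, sum_gegenbauerCoeff hn]

theorem gegenbauerCoeff_C_mul_gegenbauer {n : ℕ} (hn : 2 ≤ n) (a : ℝ) (j : ℕ) :
    gegenbauerCoeff n (C a * gegenbauer n j) = Finsupp.single j a := by
  rw [← gegenbauerCoeff_unique hn (Finsupp.single j a), Finsupp.linearCombination_single,
    smul_eq_C_mul]

/-- If `d` is the largest index in the expansion, only `P_d` contributes to the coefficient of
`t^d`, so that coefficient of `f` is nonzero. -/
theorem gegenbauerCoeff_eq_zero_of_natDegree_lt {n : ℕ} (hn : 2 ≤ n) {f : ℝ[X]} {i : ℕ}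
    (hi : f.natDegree < i) : gegenbauerCoeff n f i = 0 := by
  by_contra hne
  set c := gegenbauerCoeff n f with hc
  have hne' : c.support.Nonempty := ⟨i, Finsupp.mem_support_iff.2 hne⟩
  set d := c.support.max' hne' with hd
  have hdm : d ∈ c.support := c.support.max'_mem hne'
  have hid : i ≤ d := c.support.le_max' i (Finsupp.mem_support_iff.2 hne)
  have hcoeff : f.coeff d = c d * (gegenbauer n d).coeff d := by
    conv_lhs => rw [← sum_gegenbauerCoeff hn f]
    rw [← hc, Finsupp.linearCombination_apply, Finsupp.sum, finsetSum_coeff,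
      Finset.sum_eq_single_of_mem d hdm, coeff_smul, smul_eq_mul]
    intro l hl hld
    have hlt : l < d := lt_of_le_of_ne (c.support.le_max' l hl) hld
    rw [coeff_smul, coeff_eq_zero_of_natDegree_lt
      ((gegenbauer_natDegree_coeff hn l).1.trans_lt hlt), smul_zero]
  rw [coeff_eq_zero_of_natDegree_lt (hi.trans_le hid)] at hcoeff
  exact mul_ne_zero (Finsupp.mem_support_iff.1 hdm) (gegenbauer_natDegree_coeff hn d).2.ne'
    hcoeff.symm

/-- The error of the Levenshtein quadrature in terms of the test functions. -/
theorem IsLevenshteinQuadrature.coeff_zero_eq {n k N : ℕ} {α ρ : Fin k → ℝ}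
    (hq : IsLevenshteinQuadrature n k N α ρ) (hn : 2 ≤ n) (hk : 1 ≤ k) (f : ℝ[X]) :
    gegenbauerCoeff n f 0 = f.eval 1 / N + ∑ i, ρ i * f.eval (α i)
      - (gegenbauerCoeff n f).sum
          fun j a => if 2 * k ≤ j then a * testFunction n N α ρ j else 0 := by
  -- Both sides are linear in the coefficients. On a single `P_j` the identity is the definition of
  -- `Q_j` when `j ≥ 2k` (using `P_j(1) = 1`), and exactness otherwise.
  have key : ∀ c : ℕ →₀ ℝ, c 0 = (Finsupp.linearCombination ℝ (gegenbauer n) c).eval 1 / N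
      + ∑ i, ρ i * (Finsupp.linearCombination ℝ (gegenbauer n) c).eval (α i)
      - c.sum fun j a => if 2 * k ≤ j then a * testFunction n N α ρ j else 0 := by
    intro c
    induction c using Finsupp.induction_linear with
    | zero => simp
    | add c d hc hd =>
      rw [Finsupp.sum_add_index' (by simp) (by intro j a b; split_ifs <;> ring),
        Finsupp.add_apply, hc, hd]
      simp only [map_add, eval_add, mul_add, Finset.sum_add_distrib]
      ring
    | single j a =>
      rw [Finsupp.sum_single_index (by simp)]
      split_ifs with hj
      · rw [Finsupp.single_eq_of_ne (by omega), Finsupp.linearCombination_single, testFunction]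
        simp only [eval_smul, smul_eq_mul, gegenbauer_eval_one hn, mul_add, Finset.mul_sum]
        have : ∀ i, ρ i * (a * (gegenbauer n j).eval (α i))
            = a * (ρ i * (gegenbauer n j).eval (α i)) := fun i => by ring
        simp only [this]
        ring
      · have e := hq.exactness (Finsupp.linearCombination ℝ (gegenbauer n) (Finsupp.single j a))
          (by
            rw [Finsupp.linearCombination_single]
            refine (natDegree_smul_le _ _).trans ?_
            rw [gegenbauer_natDegree hn]; omega)
        rw [gegenbauerCoeff_unique hn] at e
        rw [e, sub_zero]
  have := key (gegenbauerCoeff n f)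
  rwa [sum_gegenbauerCoeff hn] at this

/-- The value `f(1)` cancels, leaving only the nodes in `[-1, 1)`, where `h` will be finite. -/
theorem IsLevenshteinQuadrature.lpBound_eq {n k N : ℕ} {α ρ : Fin k → ℝ}
    (hq : IsLevenshteinQuadrature n k N α ρ) (hn : 2 ≤ n) (hk : 1 ≤ k) (hN : 0 < N) (f : ℝ[X]) :
    lpBound n N f = (N : ℝ) ^ 2 * ((∑ i, ρ i * f.eval (α i))
      - (gegenbauerCoeff n f).sum
          fun j a => if 2 * k ≤ j then a * testFunction n N α ρ j else 0) := by
  have hN' : (N : ℝ) ≠ 0 := by positivity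
  rw [lpBound, hq.coeff_zero_eq hn hk f]
  field_simp
  ring

theorem delsarteBound_odd_pos {n k : ℕ} (hn : 2 ≤ n) (hk : 1 ≤ k) :
    0 < delsarteBound n (2 * k - 1) := by
  rw [delsarteBound, if_pos ⟨k - 1, by omega⟩]
  have : 0 < (n + (2 * k - 1 + 1) / 2 - 2).choose (n - 1) := Nat.choose_pos (by omega)
  omega

/-! ### Admissibility and improvement of the universal bound -/

theorem eval_le_toReal_of_mem_admissible {n τ : ℕ} {I : Set ℝ} {h : ℝ → ℝ≥0∞} {f : ℝ[X]}
    (hf : f ∈ admissible n τ I h) {t : ℝ} (ht : t ∈ I) (htop : h t ≠ ⊤) :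
    f.eval t ≤ (h t).toReal := by
  have := hf.1 t ht
  rwa [← EReal.coe_ennreal_toReal htop, EReal.coe_le_coe_iff] at this

/-- A bound by `h` on `[-1, 1)` extends to `[-1, 1]` by continuity. -/
theorem eval_le_of_eval_le_toReal {h : ℝ → ℝ≥0∞} (hfin : ∀ t ∈ Set.Ico (-1 : ℝ) 1, h t ≠ ⊤)
    (h1 : ∀ t ∈ Set.Ico (-1 : ℝ) 1, h t ≤ h 1) {f : ℝ[X]}
    (hf : ∀ t ∈ Set.Ico (-1 : ℝ) 1, f.eval t ≤ (h t).toReal) :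
    ∀ t ∈ Set.Icc (-1 : ℝ) 1, ((f.eval t : ℝ) : EReal) ≤ (h t : EReal) := by
  intro t ht
  rcases ht.2.lt_or_eq with hlt | rfl
  · rw [← EReal.coe_ennreal_toReal (hfin t ⟨ht.1, hlt⟩), EReal.coe_le_coe_iff]
    exact hf t ⟨ht.1, hlt⟩
  · by_cases htop : h 1 = ⊤
    · simp [htop]
    rw [← EReal.coe_ennreal_toReal htop, EReal.coe_le_coe_iff]
    -- Only `f` need be continuous at `1`: for `t < 1`, `f(t) ≤ h(t) ≤ h(1)`.
    have hlim : Filter.Tendsto (fun t => f.eval t) (nhdsWithin 1 (Set.Iio 1))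
        (nhds (f.eval 1)) := f.continuous.continuousAt.continuousWithinAt
    refine le_of_tendsto hlim ?_
    filter_upwards [Ico_mem_nhdsLT (show (-1 : ℝ) < 1 by norm_num)] with t ht
    exact (hf t ht).trans (ENNReal.toReal_mono htop (h1 t ht))

/-- Positivity of `h^{(m+1)}` makes `h^{(m)}` monotone, so its value at `-1` serves as `c`. This
replaces compactness, which `[-1, 1)` lacks. -/
theorem StrictlyAbsolutelyMonotone.exists_iteratedDerivWithin_ge {h : ℝ → ℝ≥0∞}
    (hh : StrictlyAbsolutelyMonotone h) (m : ℕ) :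
    ∃ c : ℝ, 0 < c ∧ ∀ t ∈ Set.Ico (-1 : ℝ) 1,
      c ≤ iteratedDerivWithin m (fun t => (h t).toReal) (Set.Ico (-1) 1) t := by
  obtain ⟨-, hsm, hpos⟩ := hh
  have hu : UniqueDiffOn ℝ (Set.Ico (-1 : ℝ) 1) := uniqueDiffOn_Ico _ _
  have hmem : (-1 : ℝ) ∈ Set.Ico (-1 : ℝ) 1 := by norm_num
  have hd : DifferentiableOn ℝ
      (iteratedDerivWithin m (fun t => (h t).toReal) (Set.Ico (-1) 1)) (Set.Ico (-1) 1) :=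
    hsm.differentiableOn_iteratedDerivWithin (by exact_mod_cast WithTop.coe_lt_top m) hu
  refine ⟨_, hpos m _ hmem, fun t ht => ?_⟩
  refine monotoneOn_of_deriv_nonneg (convex_Ico _ _) hd.continuousOn
    (hd.mono interior_subset) (fun x hx => ?_) hmem ht ht.1
  have := hpos (m + 1) x (interior_subset hx)
  rw [iteratedDerivWithin_succ, derivWithin_of_mem_nhds (mem_interior_iff_mem_nhds.1 hx)] at this
  exact this.le

theorem StrictlyAbsolutelyMonotone.exists_improvement {n k N : ℕ} (hn : 2 ≤ n) (hk : 1 ≤ k)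
    (hN : 0 < N) {α ρ : Fin k → ℝ} (hq : IsLevenshteinQuadrature n k N α ρ)
    {h : ℝ → ℝ≥0∞} (hh : StrictlyAbsolutelyMonotone h)
    (h1 : ∀ t ∈ Set.Ico (-1 : ℝ) 1, h t ≤ h 1) {j : ℕ} (hj : 2 * k ≤ j)
    (hQ : testFunction n N α ρ j < 0) :
    ∃ ε : ℝ, 0 < ε ∧ ∃ g : ℝ[X],
      IsHermiteInterpolant α (fun t => (h t).toReal - ε * (gegenbauer n j).eval t) g ∧
      C ε * gegenbauer n j + g ∈ admissible n (2 * k - 1) (Set.Icc (-1) 1) h ∧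
      (C ε * gegenbauer n j + g).natDegree = j ∧
      universalBound N α ρ h < lpBound n N (C ε * gegenbauer n j + g) := by
  classical
  set s : Set ℝ := Set.Ico (-1) 1 with hs
  have hu : UniqueDiffOn ℝ s := uniqueDiffOn_Ico _ _
  obtain ⟨c, hc, hch⟩ := hh.exists_iteratedDerivWithin_ge (2 * k)
  obtain ⟨M, hM⟩ := (isCompact_Icc (a := (-1 : ℝ)) (b := 1)).exists_bound_of_continuousOn
    (derivative^[2 * k] (gegenbauer n j)).continuous.continuousOn
  have hM0 : 0 ≤ M := (norm_nonneg _).trans (hM 1 (by norm_num))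
  -- Since `|P_j^{(2k)}| ≤ M` on `[-1, 1]`, this gives `ε P_j^{(2k)} ≤ c ≤ h^{(2k)}`; the `+ 1`
  -- covers `M = 0`.
  let ε := c / (M + 1)
  have hε : 0 < ε := by positivity
  let φ : ℝ → ℝ := fun t => (h t).toReal - ε * (gegenbauer n j).eval t
  obtain ⟨g, hgd, hg⟩ := exists_hermite_interpolant hq.strictMono.injective
    (fun i => φ (α i)) (fun i => derivWithin φ s (α i))
  let f : ℝ[X] := C ε * gegenbauer n j + g
  have hfα : ∀ i, f.eval (α i) = (h (α i)).toReal := fun i => by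
    simp [f, (hg i).1, φ]
  have hsm : ContDiffOn ℝ (2 * k : ℕ) (fun t => (h t).toReal) s :=
    contDiffOn_infty.1 hh.2.1 (2 * k)
  have hdiff : DifferentiableOn ℝ (fun t => (h t).toReal) s :=
    hh.2.1.differentiableOn (by simp)
  have hle : ∀ t ∈ s, f.eval t ≤ (h t).toReal := by
    intro t ht
    let A : Finset ℝ := Finset.univ.image α
    have hAc : A.card = k := by
      rw [Finset.card_image_of_injective _ hq.strictMono.injective, Finset.card_univ,
        Fintype.card_fin]
    have hAs : ∀ a ∈ A, a ∈ s := fun a ha => by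
      obtain ⟨i, -, rfl⟩ := Finset.mem_image.1 ha
      exact hq.mem_Ico i
    have hnonneg := nonneg_of_double_zeros (A := A) (t := t)
      (f := (fun t => (h t).toReal) - fun t => f.eval t) Set.ordConnected_Ico hu hAs
      (Finset.card_pos.1 (by omega)) (by
        rw [hAc]; exact hsm.sub (contDiff_eval f).contDiffOn)
      (fun a ha => by
        obtain ⟨i, -, rfl⟩ := Finset.mem_image.1 ha
        simp [hfα])
      (fun a ha => by
        obtain ⟨i, -, rfl⟩ := Finset.mem_image.1 ha
        have hi := hq.mem_Ico i
        have hφ : derivWithin φ s (α i) = derivWithin (fun t => (h t).toReal) s (α i)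
            - (derivative (C ε * gegenbauer n j)).eval (α i) := by
          rw [← (C ε * gegenbauer n j).derivWithin (hu _ hi), ← derivWithin_sub (hdiff _ hi)
            (Polynomial.differentiableWithinAt _)]
          congr 1
          funext t
          simp [φ]
        rw [derivWithin_sub (hdiff _ hi) (Polynomial.differentiableWithinAt _),
          f.derivWithin (hu _ hi), derivative_add, eval_add, (hg i).2, hφ]
        ring)
      (fun x hx => by
        have hg0 : derivative^[2 * k] g = 0 :=
          iterate_derivative_eq_zero (by omega)
        have hPx := hM x ⟨hx.1, hx.2.le⟩
        rw [Real.norm_eq_abs] at hPx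
        have hεc : ε * (derivative^[2 * k] (gegenbauer n j)).eval x ≤ c := by
          calc _ ≤ ε * (M + 1) :=
                mul_le_mul_of_nonneg_left
                  ((le_abs_self _).trans (hPx.trans (le_add_of_nonneg_right zero_le_one))) hε.le
            _ = c := div_mul_cancel₀ _ (by positivity)
        rw [hAc, iteratedDerivWithin_sub hx hu (hsm x hx) (contDiff_eval f).contDiffWithinAt,
          iteratedDerivWithin_polynomial_eval hu f _ hx, iterate_map_add derivative, hg0, add_zero,
          iterate_derivative_C_mul, eval_mul, eval_C]
        linarith [hch x hx]) ht
    exact sub_nonneg.1 hnonneg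
  have hcoeff : ∀ i, 2 * k ≤ i → gegenbauerCoeff n f i = Finsupp.single j ε i := fun i hi => by
    rw [gegenbauerCoeff_add hn, gegenbauerCoeff_C_mul_gegenbauer hn, Finsupp.add_apply,
      gegenbauerCoeff_eq_zero_of_natDegree_lt (f := g) hn (by omega), add_zero]
  refine ⟨ε, hε, g, ⟨hgd, hg⟩, ⟨eval_le_of_eval_le_toReal hh.1 h1 hle, fun i hi => ?_⟩, ?_, ?_⟩
  · rw [hcoeff i (by omega), Finsupp.single_apply]
    split_ifs
    exacts [hε.le, le_rfl]
  · have hdeg : (C ε * gegenbauer n j).natDegree = j := by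
      rw [natDegree_C_mul hε.ne', gegenbauer_natDegree hn]
    rw [natDegree_add_eq_left_of_natDegree_lt (by omega), hdeg]
  -- Beyond degree `2k - 1` only the coefficient `ε` of `P_j` survives, so the correction is `ε
  -- Q_j`.
  · have hsum : ((gegenbauerCoeff n f).sum
        fun i a => if 2 * k ≤ i then a * testFunction n N α ρ i else 0)
        = ε * testFunction n N α ρ j := by
      have hjc : gegenbauerCoeff n f j = ε := by rw [hcoeff j hj, Finsupp.single_eq_same]
      rw [Finsupp.sum, Finset.sum_eq_single_of_mem j
        (Finsupp.mem_support_iff.2 (by rw [hjc]; exact hε.ne')), if_pos hj, hjc]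
      intro i _ hij
      split_ifs with hi
      · rw [hcoeff i hi, Finsupp.single_eq_of_ne hij, zero_mul]
      · rfl
    have hlt := mul_neg_of_pos_of_neg hε hQ
    change _ < lpBound n N f
    rw [hq.lpBound_eq hn hk hN, universalBound, hsum]
    simp only [hfα]
    exact mul_lt_mul_of_pos_left (by linarith) (by positivity)

/-- If no test function is negative, no admissible polynomial beats the universal bound. -/
theorem lpBound_le_universalBound {n k N : ℕ} (hn : 2 ≤ n) (hk : 1 ≤ k) (hN : 0 < N)
    {α ρ : Fin k → ℝ} (hq : IsLevenshteinQuadrature n k N α ρ) {h : ℝ → ℝ≥0∞}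
    (hfin : ∀ t ∈ Set.Ico (-1 : ℝ) 1, h t ≠ ⊤)
    (hQ : ∀ j, 2 * k ≤ j → 0 ≤ testFunction n N α ρ j) {f : ℝ[X]}
    (hf : f ∈ admissible n (2 * k - 1) (Set.Icc (-1) 1) h) :
    lpBound n N f ≤ universalBound N α ρ h := by
  rw [hq.lpBound_eq hn hk hN, universalBound]
  refine mul_le_mul_of_nonneg_left ?_ (by positivity)
  have hle : ∑ i, ρ i * f.eval (α i) ≤ ∑ i, ρ i * (h (α i)).toReal :=
    Finset.sum_le_sum fun i _ => mul_le_mul_of_nonneg_left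
      (eval_le_toReal_of_mem_admissible hf (Set.Ico_subset_Icc_self (hq.mem_Ico i))
        (hfin _ (hq.mem_Ico i))) (hq.weight_pos i).le
  have hnonneg : 0 ≤ (gegenbauerCoeff n f).sum
      fun j a => if 2 * k ≤ j then a * testFunction n N α ρ j else 0 :=
    Finset.sum_nonneg fun j _ => by
      dsimp only
      split_ifs with hj
      · exact mul_nonneg (hf.2 j (by omega)) (hQ j hj)
      · exact le_rfl
  linarith

end LevenshteinLP

open LevenshteinLP
theorem theorem4p3 (n k N : ℕ) (hn : 2 ≤ n) (hk : 1 ≤ k)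
    (hN : delsarteBound n (2 * k - 1) ≤ N) (hN' : N ≤ delsarteBound n (2 * k))
    (α ρ : Fin k → ℝ) (hq : IsLevenshteinQuadrature n k N α ρ)
    (h : ℝ → ℝ≥0∞) (hh : StrictlyAbsolutelyMonotone h)
    (h1 : ∀ t ∈ Set.Ico (-1 : ℝ) 1, h t ≤ h 1) :
    ((∃ f ∈ admissible n (2 * k - 1) (Set.Icc (-1) 1) h,
        2 * k ≤ f.natDegree ∧ universalBound N α ρ h < lpBound n N f) ↔
      ∃ j, 2 * k ≤ j ∧ testFunction n N α ρ j < 0) ∧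
    ∀ j, 2 * k ≤ j → testFunction n N α ρ j < 0 →
      ∃ ε : ℝ, 0 < ε ∧ ∃ g : ℝ[X],
        IsHermiteInterpolant α
          (fun t => (h t).toReal - ε * (gegenbauer n j).eval t) g ∧
        C ε * gegenbauer n j + g ∈ admissible n (2 * k - 1) (Set.Icc (-1) 1) h ∧
        (C ε * gegenbauer n j + g).natDegree = j ∧
        universalBound N α ρ h < lpBound n N (C ε * gegenbauer n j + g) := by
  -- Positivity of `N` ensures that `1 / N` is a genuine reciprocal and that the factor `N²`
  -- preserves strict inequality.
  have hN0 : 0 < N := (delsarteBound_odd_pos hn hk).trans_le hN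
  have hb := fun j (hj : 2 * k ≤ j) (hQ : testFunction n N α ρ j < 0) =>
    hh.exists_improvement hn hk hN0 hq h1 hj hQ
  refine ⟨⟨?_, ?_⟩, hb⟩
  · rintro ⟨f, hf, -, hlt⟩
    by_contra! hQ
    exact hlt.not_ge (lpBound_le_universalBound hn hk hN0 hq hh.1 hQ hf)
  · rintro ⟨j, hj, hQ⟩
    obtain ⟨ε, -, g, -, hf, hdeg, hlt⟩ := hb j hj hQ
    exact ⟨_, hf, hdeg.symm ▸ hj, hlt⟩
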